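/- Let $\Sigma$ be a compact connected Riemann surface, $P\subset\Sigma$ a finite subset, $K_{\log}=K_\Sigma\otimes\mathcal O_\Sigma(P)$, $V$ a holomorphic vector bundle of rank $2$ on $\Sigma$ and $E=V\oplus\mathcal O_\Sigma$. Let $$\Phi=\begin{pmatrix}0&\Phi_1\\ \Phi_2&0\end{pmatrix}\in H^0(\Sigma,\operatorname{End}(E)\otimes K_{\log}),\qquad \Phi_1:\mathcal O_\Sigma\to V\otimes K_{\log},\quad \Phi_2:V\to K_{\log},$$ be an off-diagonal logarithmic Higgs field with $\operatorname{tr}(\Phi^2)=0$, $\Phi_1\not\equiv0$ and $\Phi_2\not\equiv0$ (the mixed case). For every $p\in P$ let the fibre $E_p$ carry a weighted flag $0=F_p^0\subset F_p^1\subset\dots\subset F_p^{\ell}=E_p$ with real weights $\alpha_{p,j}\in[0,1)$ attached to $F^j_p/F^{j-1}_p$, monotone (nondecreasing or nonincreasing) in $j$; write $E_*$ for the resulting parabolic bundle. A holomorphic subbundle $F\subset E$ carries the induced parabolic structure $F_*$ (intersect the flags with $F_p$), and $$\deg_{\mathrm{par}}(F_*)=\deg F+\sum_{p\in P}\sum_j\dim\frac{F_p\cap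 F_p^j}{F_p\cap F_p^{j-1}}\,\alpha_{p,j},\qquad \mu_{\mathrm{par}}(F_*)=\frac{\deg_{\mathrm{par}}(F_*)}{\operatorname{rank}F}\quad(F\neq0).$$ $F$ is $\Phi$-invariant if $\Phi(F)\subset F\otimes K_{\log}$, and $(E_*,\Phi)$ is stable if $\mu_{\mathrm{par}}(F_*)<\mu_{\mathrm{par}}(E_*)$ for every nonzero proper $\Phi$-invariant holomorphic subbundle $F\subset E$. Let $W_1\subset V$ be the saturation of the image of $\Phi_1:K_{\log}^{-1}\to V$, and let $W_2=\mathcal O_\Sigma\oplus W_1$. Then $W_1$ and $W_2$ are holomorphic subbundles of $E$ of rank $1$ and $2$, and $W_1=\ker(\Phi_2:V\to K_{\log})$. A holomorphic subbundle $F\subset E$ is nonzero, proper and $\Phi$-invariant if and only if $F=W_1$ or $F=W_2$. Moreover, $(E_*,\Phi)$ is stable if and only if $$\mu_{\mathrm{par}}(W_{1,*})<\mu_{\mathrm{par}}(E_*)\quad\text{and}\quad \mu_{\mathrm{par}}(W_{2,*})<\mu_{\mathrm{par}}(E_*).$$ -/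

import Mathlib

open Bundle Filter Topology Module
open scoped Manifold ContDiff

noncomputable section

namespace ParHiggs

section Bundles

/- `X` is a Riemann surface, `E` a holomorphic vector bundle on `X` with model fibre `F`. -/
variable {X : Type*} [TopologicalSpace X] [ChartedSpace ℂ X]
  (F : Type*) [NormedAddCommGroup F] [NormedSpace ℂ F]
  {E : X → Type*} [TopologicalSpace (TotalSpace F E)]
  [∀ x, AddCommGroup (E x)] [∀ x, Module ℂ (E x)] [∀ x, TopologicalSpace (E x)]
  [FiberBundle F E]

/-- The section `s` of `E` is holomorphic near `x`. -/
def IsHolAt (s : ∀ x, E x) (x : X) : Prop :=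
  ContMDiffAt 𝓘(ℂ) (𝓘(ℂ).prod 𝓘(ℂ, F)) ω (fun y => TotalSpace.mk' F y (s y)) x

/-- `e` is a holomorphic frame near `x` of the family of subspaces `S y ⊆ E y`. -/
def IsHolFrameAt (S : ∀ x, Submodule ℂ (E x)) {k : ℕ} (e : Fin k → ∀ x, E x) (x : X) : Prop :=
  (∀ i, IsHolAt F (e i) x) ∧
    ∀ᶠ y in 𝓝 x, LinearIndependent ℂ (fun i => e i y) ∧
      Submodule.span ℂ (Set.range fun i => e i y) = S y

variable (E) in
/-- A holomorphic subbundle of `E`: a family of subspaces of the fibres, of constant dimension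
`rank`, that has holomorphic frames locally. -/
structure HolSubbundle where
  carrier : ∀ x, Submodule ℂ (E x)
  rank : ℕ
  exists_frame : ∀ x, ∃ e : Fin rank → ∀ x, E x, IsHolFrameAt F carrier e x

/-- Near `x`, the sections `s 1, …, s k` are meromorphic sections of `S`, where `S` has rank `k`,
and `n` is the order at `x` of `s 1 ∧ … ∧ s k` as a meromorphic section of `det S`: writing
`s j = ∑ i, A i j • e i` in a holomorphic frame `e` of `S`, the order of `det A` at `x` is `n`.
In particular `s` is a frame of `S` at the points near `x` and different from `x`. -/
def IsMeromorphicFrameOfOrder (S : HolSubbundle F E) (s : Fin S.rank → ∀ x, E x)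
    (x : X) (n : ℤ) : Prop :=
  ∃ (e : Fin S.rank → ∀ x, E x) (A : X → Matrix (Fin S.rank) (Fin S.rank) ℂ),
    IsHolFrameAt F S.carrier e x ∧
    (∀ᶠ y in 𝓝[≠] x, ∀ j, s j y = ∑ i, A y i j • e i y) ∧
    (∀ i j, MeromorphicAt (fun z => A ((extChartAt 𝓘(ℂ) x).symm z) i j) (extChartAt 𝓘(ℂ) x x)) ∧
    meromorphicOrderAt (fun z => (A ((extChartAt 𝓘(ℂ) x).symm z)).det) (extChartAt 𝓘(ℂ) x x) = n

/-- `d` is the degree of the divisor of a nonzero meromorphic section `s 1 ∧ … ∧ s k` of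
`det S`. -/
def IsDegree (S : HolSubbundle F E) (d : ℤ) : Prop :=
  ∃ (s : Fin S.rank → ∀ x, E x) (D : X →₀ ℤ),
    (∀ x, IsMeromorphicFrameOfOrder F S s x (D x)) ∧ d = D.sum fun _ n => n

/-- The degree of a holomorphic (sub)bundle `S` on a compact Riemann surface, `deg S = deg det S`,
as the degree of the divisor of a meromorphic section of `det S`. On a compact Riemann surface
every bundle has a meromorphic frame, and the degree does not depend on it, since the divisor of a
meromorphic function has degree `0`. -/
def degree (S : HolSubbundle F E) : ℤ :=
  Classical.epsilon (IsDegree F S)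

end Bundles

section Whole

variable {X : Type*} [TopologicalSpace X] [ChartedSpace ℂ X]
  (F : Type*) [NormedAddCommGroup F] [NormedSpace ℂ F] [FiniteDimensional ℂ F]
  (E : X → Type*) [TopologicalSpace (TotalSpace F E)]
  [∀ x, AddCommGroup (E x)] [∀ x, Module ℂ (E x)] [∀ x, TopologicalSpace (E x)]
  [FiberBundle F E] [VectorBundle ℂ F E] [ContMDiffVectorBundle ω F E 𝓘(ℂ)]

/-- The bundle `E` as a subbundle of itself. -/
def whole : HolSubbundle F E where
  carrier := fun _ => ⊤
  rank := finrank ℂ F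
  exists_frame := fun x => by
    have h := (trivializationAt F E x).isLocalFrameOn_localFrame_baseSet 𝓘(ℂ) ω (finBasis ℂ F)
    have hU : (trivializationAt F E x).baseSet ∈ 𝓝 x :=
      (trivializationAt F E x).open_baseSet.mem_nhds (FiberBundle.mem_baseSet_trivializationAt' x)
    refine ⟨(trivializationAt F E x).localFrame (finBasis ℂ F),
      fun i => (h.contMDiffOn i).contMDiffAt hU, ?_⟩
    filter_upwards [hU] with y hy
    exact ⟨h.linearIndependent hy, top_le_iff.mp (h.generating hy)⟩

end Whole

section Saturation

variable {X : Type*} [TopologicalSpace X] [ChartedSpace ℂ X]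
  (F : Type*) [NormedAddCommGroup F] [NormedSpace ℂ F]
  {E : X → Type*} [TopologicalSpace (TotalSpace F E)]
  [∀ x, AddCommGroup (E x)] [∀ x, Module ℂ (E x)] [∀ x, TopologicalSpace (E x)]
  [FiberBundle F E] [VectorBundle ℂ F E]

/-- The fibres of the saturated subsheaf of `E` generated by a family of subspaces `G y ⊆ E y`:
a local section `s` of `E` belongs to the saturation at `x` if `s y ∈ G y` for all `y ≠ x`
near `x`. -/
def saturation (G : ∀ x, Submodule ℂ (E x)) (x : X) : Submodule ℂ (E x) where
  carrier := {w | ∃ s : ∀ y, E y, IsHolAt F s x ∧ s x = w ∧ ∀ᶠ y in 𝓝[≠] x, s y ∈ G y}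
  add_mem' := by
    rintro _ _ ⟨s, hs, rfl, hs'⟩ ⟨t, ht, rfl, ht'⟩
    refine ⟨s + t, ContMDiffAt.add_section hs ht, rfl, ?_⟩
    filter_upwards [hs', ht'] with y h1 h2 using (G y).add_mem h1 h2
  zero_mem' := ⟨0, contMDiff_zeroSection ℂ E x, rfl, Eventually.of_forall fun y => (G y).zero_mem⟩
  smul_mem' := by
    rintro c _ ⟨s, hs, rfl, hs'⟩
    refine ⟨c • s, ContMDiffAt.const_smul_section hs, rfl, ?_⟩
    filter_upwards [hs'] with y h1 using (G y).smul_mem c h1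

end Saturation

section Higgs

variable {X : Type*} [TopologicalSpace X] [ChartedSpace ℂ X] [IsManifold 𝓘(ℂ) ω X]
  (P : Finset X)
  (F : Type*) [NormedAddCommGroup F] [NormedSpace ℂ F]
  (E : X → Type*) [TopologicalSpace (TotalSpace F E)]
  [∀ x, AddCommGroup (E x)] [∀ x, Module ℂ (E x)] [∀ x, TopologicalSpace (E x)]
  [∀ x, IsTopologicalAddGroup (E x)] [∀ x, ContinuousSMul ℂ (E x)]
  [FiberBundle F E] [VectorBundle ℂ F E]

/-- The coordinate vector field `∂/∂z` of the chart `z` at `x`, evaluated at `y`. -/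
def coordVector (x y : X) : TangentSpace 𝓘(ℂ) y :=
  (trivializationAt ℂ (TangentSpace 𝓘(ℂ) : X → Type _) x).symm y (1 : ℂ)

open Classical in
/-- A logarithmic Higgs field `Φ ∈ H⁰(X, End E ⊗ K_X(P))`: a holomorphic `End E`-valued one-form
`form` on `X ∖ P` with at most a simple pole at each `p ∈ P`, where `res p` is its residue at `p`.
In a chart `z` at `p` with `z(p) = 0` the pole condition says that `z • Φ(∂/∂z)`, with the value
`res p` at `p`, is a holomorphic section of `End E` near `p`. The values of `form` on `P` and
of `res` off `P` carry no information and are never used. -/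
structure LogHiggsField where
  form : ∀ x, TangentSpace 𝓘(ℂ) x →L[ℂ] (E x →L[ℂ] E x)
  res : ∀ x, E x →L[ℂ] E x
  holomorphic : ∀ x, x ∉ P →
    IsHolAt (F →L[ℂ] F) (E := fun y => E y →L[ℂ] E y) (fun y => form y (coordVector x y)) x
  simple_pole : ∀ p ∈ P,
    IsHolAt (F →L[ℂ] F) (E := fun y => E y →L[ℂ] E y)
      (fun y => if y = p then res y else
        (extChartAt 𝓘(ℂ) p y - extChartAt 𝓘(ℂ) p p) • form y (coordVector p y)) p

variable {P F E}

/-- `Φ(S) ⊆ S ⊗ K_X(P)`, fibre by fibre: at `p ∈ P` the fibre of `K_X(P)` is `ℂ`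
by the residue. -/
def IsInvariant (Φ : LogHiggsField P F E) (S : HolSubbundle F E) : Prop :=
  (∀ x, x ∉ P → ∀ v, ∀ w ∈ S.carrier x, Φ.form x v w ∈ S.carrier x) ∧
    ∀ p ∈ P, ∀ w ∈ S.carrier p, Φ.res p w ∈ S.carrier p

end Higgs

section Parabolic

/-- A weighted flag `0 = F⁰ ⊆ F¹ ⊆ … ⊆ F^ℓ = W` with a weight in `[0, 1)` on each quotient
`F^(j+1)/F^j`. The weights are ordered along the flag; both conventions (nondecreasing for
increasing flags, or nondecreasing for decreasing flags) are allowed. Trivial steps `F^(j+1) = F^j`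
do not contribute to the total weight. -/
structure WeightedFlag (W : Type*) [AddCommGroup W] [Module ℂ W] where
  length : ℕ
  flag : Fin (length + 1) → Submodule ℂ W
  flag_mono : Monotone flag
  flag_zero : flag 0 = ⊥
  flag_last : flag (Fin.last length) = ⊤
  weight : Fin length → ℝ
  weight_nonneg : ∀ j, 0 ≤ weight j
  weight_lt_one : ∀ j, weight j < 1
  weight_ordered : Monotone weight ∨ Antitone weight

variable {W : Type*} [AddCommGroup W] [Module ℂ W]

/-- The flag induced on a subspace by intersection. -/
def WeightedFlag.induced (f : WeightedFlag W) (U : Submodule ℂ W) : WeightedFlag U where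
  length := f.length
  flag := fun j => (f.flag j).comap U.subtype
  flag_mono := fun _ _ h => Submodule.comap_mono (f.flag_mono h)
  flag_zero := by simp [f.flag_zero]
  flag_last := by simp [f.flag_last]
  weight := f.weight
  weight_nonneg := f.weight_nonneg
  weight_lt_one := f.weight_lt_one
  weight_ordered := f.weight_ordered

/-- The sum of the weights, with multiplicities `dim F^(j+1)/F^j`. -/
def WeightedFlag.totalWeight (f : WeightedFlag W) : ℝ :=
  ∑ j : Fin f.length,
    ((finrank ℂ (f.flag j.succ) : ℝ) - (finrank ℂ (f.flag j.castSucc) : ℝ)) * f.weight j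

variable {X : Type*} [TopologicalSpace X] [ChartedSpace ℂ X]
  {P : Finset X}
  {F : Type*} [NormedAddCommGroup F] [NormedSpace ℂ F]
  {E : X → Type*} [TopologicalSpace (TotalSpace F E)]
  [∀ x, AddCommGroup (E x)] [∀ x, Module ℂ (E x)] [∀ x, TopologicalSpace (E x)]
  [FiberBundle F E]

/-- The parabolic degree of a subbundle `S` with the parabolic structure induced by the weighted
flags `par p` on the fibres `E p`, `p ∈ P`. -/
def parDegree (par : ∀ p : P, WeightedFlag (E p)) (S : HolSubbundle F E) : ℝ :=
  (degree F S : ℝ) + ∑ p : P, ((par p).induced (S.carrier p)).totalWeight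

/-- The parabolic slope. -/
def parSlope (par : ∀ p : P, WeightedFlag (E p)) (S : HolSubbundle F E) : ℝ :=
  parDegree par S / S.rank

/-- Stability of the parabolic Higgs bundle `(E, par, Φ)`. -/
def IsStable [IsManifold 𝓘(ℂ) ω X] [FiniteDimensional ℂ F] [∀ x, IsTopologicalAddGroup (E x)]
    [∀ x, ContinuousSMul ℂ (E x)] [VectorBundle ℂ F E] [ContMDiffVectorBundle ω F E 𝓘(ℂ)]
    (par : ∀ p : P, WeightedFlag (E p)) (Φ : LogHiggsField P F E) : Prop :=
  ∀ S : HolSubbundle F E, 0 < S.rank → S.rank < finrank ℂ F → IsInvariant Φ S →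
    parSlope par S < parSlope par (whole F E)

end Parabolic

section OffDiagonal

variable {X : Type*} [TopologicalSpace X] [ChartedSpace ℂ X] [IsManifold 𝓘(ℂ) ω X]
  {P : Finset X}
  {F : Type*} [NormedAddCommGroup F] [NormedSpace ℂ F]
  {V : X → Type*} [TopologicalSpace (TotalSpace F V)]
  [∀ x, AddCommGroup (V x)] [∀ x, Module ℂ (V x)] [∀ x, TopologicalSpace (V x)]
  [∀ x, IsTopologicalAddGroup (V x)] [∀ x, ContinuousSMul ℂ (V x)]
  [FiberBundle F V] [VectorBundle ℂ F V]
  (Φ : LogHiggsField P (F × ℂ) (V ×ᵇ Bundle.Trivial X ℂ))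

/-- The block `Φ₁ : 𝒪 → V ⊗ K_X(P)` of a Higgs field on `V ⊕ 𝒪`. -/
def block₁ (x : X) (v : TangentSpace 𝓘(ℂ) x) (c : ℂ) : V x :=
  (Φ.form x v ((0 : V x), c)).1

/-- The block `Φ₂ : V → 𝒪 ⊗ K_X(P)` of a Higgs field on `V ⊕ 𝒪`. -/
def block₂ (x : X) (v : TangentSpace 𝓘(ℂ) x) (u : V x) : ℂ :=
  (Φ.form x v (u, (0 : ℂ))).2

/-- `Φ` is off-diagonal with respect to `V ⊕ 𝒪`. -/
def IsOffDiagonal : Prop :=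
  ∀ x, x ∉ P → ∀ (v : TangentSpace 𝓘(ℂ) x) (u : V x) (c : ℂ),
    Φ.form x v (u, c) = (block₁ Φ x v c, block₂ Φ x v u)

/-- The quadratic differential `tr (Φ²)` vanishes. -/
def TraceSqEqZero : Prop :=
  ∀ x, x ∉ P → ∀ v : TangentSpace 𝓘(ℂ) x,
    LinearMap.trace ℂ (V x × ℂ) ((Φ.form x v : (V x × ℂ) →ₗ[ℂ] V x × ℂ) ∘ₗ
      (Φ.form x v : (V x × ℂ) →ₗ[ℂ] V x × ℂ)) = 0

/-- The fibrewise image of `Φ₁`, in `V ⊕ 0 ⊆ V ⊕ 𝒪`. -/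
def imageBlock₁ (x : X) : Submodule ℂ (V x × ℂ) :=
  Submodule.span ℂ {w | ∃ v c, w = (block₁ Φ x v c, (0 : ℂ))}

/-- The fibrewise kernel of `Φ₂`, in `V ⊕ 0 ⊆ V ⊕ 𝒪`. -/
def kerBlock₂ (x : X) : Submodule ℂ (V x × ℂ) where
  carrier := {w | w.2 = 0 ∧ ∀ v, block₂ Φ x v w.1 = 0}
  add_mem' := by
    rintro ⟨a, a'⟩ ⟨b, b'⟩ ⟨ha, ha'⟩ ⟨hb, hb'⟩
    simp only at ha hb ha' hb'
    refine ⟨by simp [ha, hb], fun v => ?_⟩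
    have h : ((a + b, (0 : ℂ)) : V x × ℂ) = (a, 0) + (b, 0) := by simp
    have := map_add (Φ.form x v) ((a, (0 : ℂ)) : V x × ℂ) (b, (0 : ℂ))
    rw [← h] at this
    have h2 := congrArg Prod.snd this
    exact h2.trans (by
      have h3 := congrArg₂ (· + ·) (ha' v) (hb' v)
      simpa [block₂] using h3)
  zero_mem' := ⟨rfl, fun v => by
    have := map_zero (Φ.form x v)
    exact congrArg Prod.snd this⟩
  smul_mem' := by
    rintro c ⟨a, a'⟩ ⟨ha, ha'⟩
    simp only at ha ha'
    refine ⟨by simp [ha], fun v => ?_⟩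
    have h : ((c • a, (0 : ℂ)) : V x × ℂ) = c • (a, 0) := by simp
    have := map_smul (Φ.form x v) c ((a, (0 : ℂ)) : V x × ℂ)
    rw [← h] at this
    have h2 := congrArg Prod.snd this
    exact h2.trans (by
      have h3 := congrArg (c * ·) (ha' v)
      simpa [block₂] using h3)

/-- The fibres of `W₁`, the saturation of the image of `Φ₁`. -/
def W₁ (x : X) : Submodule ℂ (V x × ℂ) :=
  saturation (F × ℂ) (E := V ×ᵇ Bundle.Trivial X ℂ) (imageBlock₁ Φ) x

/-- The fibres of `W₂ = 𝒪 ⊕ W₁`. -/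
def W₂ (x : X) : Submodule ℂ (V x × ℂ) :=
  Submodule.prod ⊥ ⊤ ⊔ W₁ Φ x

end OffDiagonal

end ParHiggs

end

open ParHiggs

set_option linter.unusedSectionVars false

/-! At a point `y` outside `P`, evaluating `Φ` on a tangent vector spanning the tangent line gives
`T (u, c) = (c • a, b u)`. Here `T²` has trace `2 * b a`, so the trace condition means `b a = 0`. By
the identity principle `a` and `b` are both nonzero off a discrete set. There `T` is a nilpotent
with a single Jordan block of size 3, so its only nonzero proper invariant subspaces are the line
`ker T`, spanned by `(a, 0)`, and the plane `ker T²`, spanned by `(a, 0)` and `(0, 1)`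
(`eventually_isRegularNilpotentAt`, `eq_span_or_eq_sup_of_invariant`).

This pointwise statement becomes global because a subbundle is closed in the total space
(`IsHolFrameAt.mem_of_frequently`). Hence its fibres off a discrete set determine it, and invariance
need only be checked there. The line and plane extend over the exceptional points by dividing the
section `Φ₁(1)` by a power of a local coordinate (`exists_generator`). Thus `W₁` and `W₂` are the
only invariant subbundles to test (`isInvariant_iff`), and the stability criterion follows without
computing any degree or weight. -/

namespace ParHiggs

/-! ### Isolated zeros and the identity principle on a Riemann surface -/

section RiemannSurface

variable {X : Type*} [TopologicalSpace X] [ChartedSpace ℂ X]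

/-- A chart would carry an open singleton to an open singleton of `ℂ`. This lets properties valid on
punctured neighbourhoods be realised at actual points. -/
instance nhdsNE_neBot (x : X) : (𝓝[≠] x).NeBot := by
  rw [neBot_iff, ne_eq, ← isOpen_singleton_iff_punctured_nhds]
  intro h
  have h2 := (chartAt ℂ x).isOpen_image_of_subset_source h (by simp)
  rw [Set.image_singleton, isOpen_singleton_iff_punctured_nhds] at h2
  exact NeBot.ne inferInstance h2

theorem tendsto_extChartAt_nhdsNE (x : X) :
    Tendsto (extChartAt 𝓘(ℂ) x) (𝓝[≠] x) (𝓝[≠] (extChartAt 𝓘(ℂ) x x)) := by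
  refine tendsto_nhdsWithin_iff.2
    ⟨(continuousAt_extChartAt x).tendsto.mono_left nhdsWithin_le_nhds, ?_⟩
  filter_upwards [nhdsWithin_le_nhds (extChartAt_source_mem_nhds (I := 𝓘(ℂ)) x),
    self_mem_nhdsWithin] with y hy hne h
  exact hne ((extChartAt 𝓘(ℂ) x).injOn hy (mem_extChartAt_source x) h)

/-- The identity principle on a connected surface, for a property that near every point either
holds or fails, the point itself excepted. -/
theorem eventually_not_of_dichotomy [T1Space X] [PreconnectedSpace X] {p : X → Prop}
    (hp : ∀ x, (∀ᶠ y in 𝓝[≠] x, p y) ∨ ∀ᶠ y in 𝓝[≠] x, ¬ p y)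
    (hx : ∃ x, ∀ᶠ y in 𝓝[≠] x, ¬ p y) (x : X) : ∀ᶠ y in 𝓝[≠] x, ¬ p y := by
  -- Validity on a punctured neighbourhood is an open condition: a point `y ≠ x` close to `x` has a
  -- neighbourhood avoiding `x`.
  have key : ∀ q : X → Prop, IsOpen {x | ∀ᶠ y in 𝓝[≠] x, q y} := by
    intro q
    rw [isOpen_iff_mem_nhds]
    intro x hx
    have h1 : ∀ᶠ y in 𝓝 x, y ≠ x → q y := eventually_nhdsWithin_iff.1 hx
    filter_upwards [eventually_eventually_nhds.2 h1] with y hy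
    rcases eq_or_ne y x with rfl | hne
    · exact hx
    · filter_upwards [nhdsWithin_le_nhds hy, nhdsWithin_le_nhds (eventually_ne_nhds hne)]
        with z hz hzx using hz hzx
  have hclopen : IsClopen {x | ∀ᶠ y in 𝓝[≠] x, ¬ p y} := by
    refine ⟨⟨?_⟩, key _⟩
    convert key p using 1
    ext x
    change ¬ (∀ᶠ y in 𝓝[≠] x, ¬ p y) ↔ ∀ᶠ y in 𝓝[≠] x, p y
    refine ⟨(hp x).resolve_right, fun h h' => ?_⟩
    obtain ⟨y, h1, h2⟩ := (h.and h').exists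
    exact h2 h1
  have := hclopen.eq_univ hx
  exact this.ge (Set.mem_univ x)

variable [IsManifold 𝓘(ℂ) ω X]

theorem analyticAt_comp_extChartAt_symm {G : Type*} [NormedAddCommGroup G] [NormedSpace ℂ G]
    {f : X → G} {x : X} (hf : ContMDiffAt 𝓘(ℂ) 𝓘(ℂ, G) ω f x) :
    AnalyticAt ℂ (f ∘ (extChartAt 𝓘(ℂ) x).symm) (extChartAt 𝓘(ℂ) x x) := by
  apply ContDiffAt.analyticAt
  rw [← contMDiffAt_iff_contDiffAt]
  have h2 : ContMDiffAt 𝓘(ℂ) 𝓘(ℂ) ω (extChartAt 𝓘(ℂ) x).symm (extChartAt 𝓘(ℂ) x x) :=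
    (contMDiffOn_extChartAt_symm x).contMDiffAt (extChartAt_target_mem_nhds x)
  refine ContMDiffAt.comp _ ?_ h2
  rwa [extChartAt_to_inv]

/-- A holomorphic function either vanishes near `x` or factors as a power of a local coordinate
times a holomorphic function that does not vanish at `x`. -/
theorem eventually_eq_zero_or_exists_factorization
    {G : Type*} [NormedAddCommGroup G] [NormedSpace ℂ G] [CompleteSpace G]
    {f : X → G} {x : X} (hf : ContMDiffAt 𝓘(ℂ) 𝓘(ℂ, G) ω f x) :
    (∀ᶠ y in 𝓝 x, f y = 0) ∨ ∃ g : X → G, ContMDiffAt 𝓘(ℂ) 𝓘(ℂ, G) ω g x ∧ g x ≠ 0 ∧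
      ∃ c : X → ℂ, (∀ᶠ y in 𝓝[≠] x, c y ≠ 0) ∧ ∀ᶠ y in 𝓝 x, f y = c y • g y := by
  have ha := analyticAt_comp_extChartAt_symm hf
  have hsrc := extChartAt_source_mem_nhds (I := 𝓘(ℂ)) x
  have hcont := continuousAt_extChartAt (I := 𝓘(ℂ)) x
  by_cases h0 : ∀ᶠ z in 𝓝 (extChartAt 𝓘(ℂ) x x), (f ∘ (extChartAt 𝓘(ℂ) x).symm) z = 0
  · left
    filter_upwards [hcont.eventually h0, hsrc] with y hy hys
    rwa [Function.comp_apply, (extChartAt 𝓘(ℂ) x).left_inv hys] at hy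
  · right
    -- Here `n` is the vanishing order in the chart; the scalar factor will be the `n`-th power of
    -- the centred coordinate.
    obtain ⟨n, g, hg, hg0, hfg⟩ := ha.exists_eventuallyEq_pow_smul_nonzero_iff.2 h0
    refine ⟨g ∘ extChartAt 𝓘(ℂ) x, hg.contDiffAt.contMDiffAt.comp _ contMDiffAt_extChartAt, hg0,
      fun y => (extChartAt 𝓘(ℂ) x y - extChartAt 𝓘(ℂ) x x) ^ n, ?_, ?_⟩
    · filter_upwards [(tendsto_extChartAt_nhdsNE x).eventually self_mem_nhdsWithin] with y hy
      exact pow_ne_zero _ (sub_ne_zero.2 hy)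
    · filter_upwards [hcont.eventually hfg, hsrc] with y hy hys
      rwa [Function.comp_apply, (extChartAt 𝓘(ℂ) x).left_inv hys] at hy

theorem eventually_eq_zero_or_eventually_ne_zero
    {G : Type*} [NormedAddCommGroup G] [NormedSpace ℂ G] [CompleteSpace G]
    {f : X → G} {x : X} (hf : ContMDiffAt 𝓘(ℂ) 𝓘(ℂ, G) ω f x) :
    (∀ᶠ y in 𝓝 x, f y = 0) ∨ ∀ᶠ y in 𝓝[≠] x, f y ≠ 0 := by
  refine (eventually_eq_zero_or_exists_factorization hf).imp_right ?_
  rintro ⟨g, hg, hg0, c, hc, hfg⟩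
  filter_upwards [hc, nhdsWithin_le_nhds hfg,
    nhdsWithin_le_nhds (hg.continuousAt.eventually_ne hg0)] with y h1 h2 h3
  rw [h2]
  exact smul_ne_zero h1 h3

end RiemannSurface

/-! ### Closedness of subbundles and their saturations -/

section Bundles

variable {X : Type*} [TopologicalSpace X] [ChartedSpace ℂ X]
  {F : Type*} [NormedAddCommGroup F] [NormedSpace ℂ F]
  {E : X → Type*} [TopologicalSpace (TotalSpace F E)]
  [∀ x, AddCommGroup (E x)] [∀ x, Module ℂ (E x)] [∀ x, TopologicalSpace (E x)]
  [FiberBundle F E] [VectorBundle ℂ F E]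

theorem eventually_mem_baseSet (x : X) : ∀ᶠ y in 𝓝 x, y ∈ (trivializationAt F E x).baseSet :=
  (trivializationAt F E x).open_baseSet.mem_nhds (FiberBundle.mem_baseSet_trivializationAt' x)

variable (F) in
/-- The section `s` in the preferred trivialization of `E` at `x`. -/
noncomputable def coordAt (x : X) (s : ∀ y, E y) (y : X) : F :=
  (trivializationAt F E x).linearMapAt ℂ y (s y)

theorem isHolAt_iff_coordAt {s : ∀ y, E y} {x : X} :
    IsHolAt F s x ↔ ContMDiffAt 𝓘(ℂ) 𝓘(ℂ, F) ω (coordAt F x s) x := by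
  rw [IsHolAt, contMDiffAt_section]
  apply Filter.EventuallyEq.contMDiffAt_iff
  filter_upwards [eventually_mem_baseSet (F := F) (E := E) x] with y hy
  rw [coordAt, (trivializationAt F E x).coe_linearMapAt_of_mem hy]

theorem linearMapAt_injective {x y : X} (hy : y ∈ (trivializationAt F E x).baseSet) :
    Function.Injective ((trivializationAt F E x).linearMapAt ℂ y) := by
  rw [(trivializationAt F E x).linearMapAt_def_of_mem hy]
  exact ((trivializationAt F E x).linearEquivAt ℂ y hy).injective

theorem coordAt_ne_zero_iff {s : ∀ y, E y} {x y : X}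
    (hy : y ∈ (trivializationAt F E x).baseSet) : coordAt F x s y ≠ 0 ↔ s y ≠ 0 :=
  (map_ne_zero_iff _ (linearMapAt_injective hy))

theorem linearIndependent_coordAt_iff {k : ℕ} {e : Fin k → ∀ y, E y} {x y : X}
    (hy : y ∈ (trivializationAt F E x).baseSet) :
    LinearIndependent ℂ (fun i => coordAt F x (e i) y) ↔ LinearIndependent ℂ fun i => e i y :=
  LinearMap.linearIndependent_iff_of_injOn _ (linearMapAt_injective hy).injOn

/-- Independence of a finite family is an open condition in the fixed space `F`, and a
trivialization transports it to the fibres. -/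
theorem IsHolAt.eventually_linearIndependent {k : ℕ} {e : Fin k → ∀ y, E y} {x : X}
    (he : ∀ i, IsHolAt F (e i) x) (h : LinearIndependent ℂ fun i => e i x) :
    ∀ᶠ y in 𝓝 x, LinearIndependent ℂ fun i => e i y := by
  have hx := (linearIndependent_coordAt_iff (F := F)
    (FiberBundle.mem_baseSet_trivializationAt' x)).2 h
  have hc : ContinuousAt (fun y i => coordAt F x (e i) y) x :=
    continuousAt_pi.2 fun i => (isHolAt_iff_coordAt.1 (he i)).continuousAt
  filter_upwards [hc.eventually hx.eventually, eventually_mem_baseSet (F := F) (E := E) x]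
    with y hy hyb
  exact (linearIndependent_coordAt_iff hyb).1 hy

theorem IsHolFrameAt.linearIndependent {S : ∀ y, Submodule ℂ (E y)} {k : ℕ}
    {e : Fin k → ∀ y, E y} {x : X} (he : IsHolFrameAt F S e x) :
    LinearIndependent ℂ fun i => e i x := he.2.self_of_nhds.1

theorem IsHolFrameAt.span_eq {S : ∀ y, Submodule ℂ (E y)} {k : ℕ}
    {e : Fin k → ∀ y, E y} {x : X} (he : IsHolFrameAt F S e x) :
    Submodule.span ℂ (Set.range fun i => e i x) = S x := he.2.self_of_nhds.2

theorem HolSubbundle.finrank_carrier (S : HolSubbundle F E) (x : X) :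
    finrank ℂ (S.carrier x) = S.rank := by
  obtain ⟨e, he⟩ := S.exists_frame x
  rw [← he.span_eq, finrank_span_eq_card he.linearIndependent, Fintype.card_fin]

theorem HolSubbundle.eq_of_carrier_eq {S T : HolSubbundle F E} (hc : S.carrier = T.carrier)
    (hr : S.rank = T.rank) : S = T := by
  cases S; cases T; cases hc; cases hr; rfl

/-- The total space of a holomorphic subbundle is closed. -/
theorem IsHolFrameAt.mem_of_frequently {S : ∀ y, Submodule ℂ (E y)} {k : ℕ}
    {e : Fin k → ∀ y, E y} {x : X} (he : IsHolFrameAt F S e x) {s : ∀ y, E y}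
    (hs : IsHolAt F s x) (h : ∃ᶠ y in 𝓝 x, s y ∈ S y) : s x ∈ S x := by
  by_contra hx
  rw [← he.span_eq] at hx
  -- If `s x` left `S x`, adjoining `s` to the frame would give `k + 1` vectors independent at `x`,
  -- hence nearby, contradicting `s y ∈ S y` at points arbitrarily close to `x`.
  have hli : LinearIndependent ℂ fun i => (Fin.cons s e : Fin (k + 1) → ∀ y, E y) i x := by
    have : (fun i => (Fin.cons s e : Fin (k + 1) → ∀ y, E y) i x) =
        Fin.cons (s x) fun i => e i x := by
      ext i; refine Fin.cases ?_ (fun i => ?_) i <;> simp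
    rw [this]
    exact linearIndependent_finCons.2 ⟨he.linearIndependent, hx⟩
  have hev := IsHolAt.eventually_linearIndependent
    (Fin.cases (by simpa using hs) (by simpa using he.1)) hli
  obtain ⟨y, hy, h1, h2⟩ := (h.and_eventually (hev.and he.2)).exists
  have : (fun i => (Fin.cons s e : Fin (k + 1) → ∀ y, E y) i y) =
      Fin.cons (s y) fun i => e i y := by
    ext i; refine Fin.cases ?_ (fun i => ?_) i <;> simp
  rw [this, linearIndependent_finCons, h2.2] at h1
  exact h1.2 hy

theorem IsHolAt.sum_smul {k : ℕ} {e : Fin k → ∀ y, E y} {x : X}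
    (he : ∀ i, IsHolAt F (e i) x) (c : Fin k → ℂ) : IsHolAt F (fun y => ∑ i, c i • e i y) x := by
  rw [isHolAt_iff_coordAt]
  have : coordAt F x (fun y => ∑ i, c i • e i y) = fun y => ∑ i, c i • coordAt F x (e i) y := by
    ext y; simp [coordAt, map_sum]
  rw [this]
  have h : ∀ i, ContMDiffAt 𝓘(ℂ) 𝓘(ℂ, F) ω (fun y => c i • coordAt F x (e i) y) x := fun i =>
    ((c i) • ContinuousLinearMap.id ℂ F).contMDiff.contMDiffAt.comp x
      (isHolAt_iff_coordAt.1 (he i))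
  exact contMDiffAt_finsetSum fun i _ => h i

/-- Every vector of a subbundle extends to a local holomorphic section of the subbundle. -/
theorem IsHolFrameAt.exists_section {S : ∀ y, Submodule ℂ (E y)} {k : ℕ}
    {e : Fin k → ∀ y, E y} {x : X} (he : IsHolFrameAt F S e x) {w : E x} (hw : w ∈ S x) :
    ∃ s : ∀ y, E y, IsHolAt F s x ∧ s x = w ∧ ∀ᶠ y in 𝓝 x, s y ∈ S y := by
  rw [← he.span_eq, Submodule.mem_span_range_iff_exists_fun] at hw
  obtain ⟨c, rfl⟩ := hw
  refine ⟨fun y => ∑ i, c i • e i y, IsHolAt.sum_smul he.1 c, rfl, ?_⟩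
  filter_upwards [he.2] with y hy
  rw [← hy.2]
  exact Submodule.sum_mem _ fun i _ =>
    Submodule.smul_mem _ _ (Submodule.subset_span ⟨i, rfl⟩)

/-- Closedness of `S` gives one inclusion, extension of vectors to local sections of `S` the other.
With `G = S`, a subbundle is its own saturation. -/
theorem IsHolFrameAt.saturation_eq {S : ∀ y, Submodule ℂ (E y)} {k : ℕ}
    {e : Fin k → ∀ y, E y} {x : X} (he : IsHolFrameAt F S e x) {G : ∀ y, Submodule ℂ (E y)}
    (hG : ∀ᶠ y in 𝓝[≠] x, G y = S y) : saturation F G x = S x := by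
  ext w
  constructor
  · rintro ⟨s, hs, rfl, h⟩
    have h2 : ∀ᶠ y in 𝓝[≠] x, s y ∈ S y := by
      filter_upwards [h, hG] with y h1 h2 using h2 ▸ h1
    exact he.mem_of_frequently hs (h2.frequently.filter_mono nhdsWithin_le_nhds)
  · intro hw
    obtain ⟨s, hs, hsx, h⟩ := he.exists_section hw
    refine ⟨s, hs, hsx, ?_⟩
    filter_upwards [nhdsWithin_le_nhds h, hG] with y h1 h2 using h2 ▸ h1

variable [IsManifold 𝓘(ℂ) ω X]

/-- A holomorphic section that does not vanish near `x` is, away from `x`, a multiple of a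
holomorphic section that does not vanish at `x`. -/
theorem eventually_eq_zero_or_exists_saturated [CompleteSpace F] {s : ∀ y, E y} {x : X} (hs : IsHolAt F s x) :
    (∀ᶠ y in 𝓝[≠] x, s y = 0) ∨ ∃ σ : ∀ y, E y, IsHolAt F σ x ∧ σ x ≠ 0 ∧
      ∃ c : X → ℂ, (∀ᶠ y in 𝓝[≠] x, c y ≠ 0) ∧ ∀ᶠ y in 𝓝 x, s y = c y • σ y := by
  set t := trivializationAt F E x with ht
  have hb := eventually_mem_baseSet (F := F) (E := E) x
  rcases eventually_eq_zero_or_exists_factorization (isHolAt_iff_coordAt.1 hs) with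
    h | ⟨g, hg, hg0, c, hc, hfg⟩
  · left
    filter_upwards [nhdsWithin_le_nhds h, nhdsWithin_le_nhds hb] with y hy hyb
    by_contra hne
    exact (coordAt_ne_zero_iff hyb).2 hne hy
  · right
    have hcoord : ∀ y ∈ t.baseSet, coordAt F x (fun y => t.symmₗ ℂ y (g y) : ∀ y, E y) y = g y :=
      fun y hy => t.linearMapAt_symmₗ hy _
    have hxb : x ∈ t.baseSet := FiberBundle.mem_baseSet_trivializationAt' x
    refine ⟨fun y => t.symmₗ ℂ y (g y), ?_, ?_, c, hc, ?_⟩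
    · rw [isHolAt_iff_coordAt]
      exact hg.congr_of_eventuallyEq (hb.mono hcoord)
    · rw [← coordAt_ne_zero_iff (s := fun y => t.symmₗ ℂ y (g y)) hxb, hcoord x hxb]
      exact hg0
    · filter_upwards [hfg, hb] with y hy hyb
      apply linearMapAt_injective hyb
      rw [map_smul]
      exact hy.trans (congrArg _ (hcoord y hyb).symm)

variable [ContMDiffVectorBundle ω F E 𝓘(ℂ)]

theorem IsHolAt.eventually {s : ∀ y, E y} {x : X} (hs : IsHolAt F s x) :
    ∀ᶠ y in 𝓝 x, IsHolAt F s y :=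
  (contMDiffAt_iff_contMDiffAt_nhds (by simp)).1 hs

theorem IsHolFrameAt.eventually {S : ∀ y, Submodule ℂ (E y)} {k : ℕ}
    {e : Fin k → ∀ y, E y} {x : X} (he : IsHolFrameAt F S e x) :
    ∀ᶠ y in 𝓝 x, IsHolFrameAt F S e y := by
  filter_upwards [eventually_all.2 fun i => (he.1 i).eventually,
    eventually_eventually_nhds.2 he.2] with y h1 h2 using ⟨h1, h2⟩

/-- If `G` agrees with a subbundle near `x`, the point `x` excepted, then so does its
saturation, `x` included. -/
theorem IsHolFrameAt.saturation [T1Space X] {S : ∀ y, Submodule ℂ (E y)} {k : ℕ}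
    {e : Fin k → ∀ y, E y} {x : X} (he : IsHolFrameAt F S e x) {G : ∀ y, Submodule ℂ (E y)}
    (hG : ∀ᶠ y in 𝓝[≠] x, G y = S y) : IsHolFrameAt F (ParHiggs.saturation F G) e x := by
  -- A frame of the saturation needs its fibres at all points near `x`, so the hypothesis on `G` is
  -- moved to punctured neighbourhoods of those points.
  have h : ∀ᶠ y in 𝓝 x, ∀ᶠ z in 𝓝[≠] y, G z = S z := by
    have h1 : ∀ᶠ y in 𝓝 x, y ≠ x → G y = S y := eventually_nhdsWithin_iff.1 hG
    filter_upwards [eventually_eventually_nhds.2 h1] with y hy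
    rcases eq_or_ne y x with rfl | hne
    · exact hG
    · filter_upwards [nhdsWithin_le_nhds hy, nhdsWithin_le_nhds (eventually_ne_nhds hne)]
        with z hz hzx using hz hzx
  refine ⟨he.1, ?_⟩
  filter_upwards [h, he.eventually] with y h1 h2
  rw [h2.saturation_eq h1]
  exact h2.2.self_of_nhds

end Bundles

/-! ### Off-diagonal nilpotent endomorphisms and their invariant subspaces -/

section LinearAlgebra

variable {W : Type*} [AddCommGroup W] [Module ℂ W] {a : W} {b : W →ₗ[ℂ] ℂ}
  {T : W × ℂ →ₗ[ℂ] W × ℂ}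

/-- The square is block diagonal, with blocks `u ↦ b u • a` on `W` and multiplication by `b a` on
`ℂ`; each has trace `b a`. -/
theorem trace_comp_self_of_offDiagonal [FiniteDimensional ℂ W]
    (hT : ∀ u c, T (u, c) = (c • a, b u)) :
    LinearMap.trace ℂ (W × ℂ) (T ∘ₗ T) = 2 * b a := by
  have h : T ∘ₗ T = LinearMap.prodMap (LinearMap.toSpanSingleton ℂ W a ∘ₗ b)
      (b ∘ₗ LinearMap.toSpanSingleton ℂ W a) := by
    refine LinearMap.ext fun w => ?_
    obtain ⟨u, c⟩ := w
    simp [hT]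
  have h2 : LinearMap.trace ℂ ℂ (b ∘ₗ LinearMap.toSpanSingleton ℂ W a) = b a := by
    rw [LinearMap.trace_eq_matrix_trace ℂ (Basis.singleton Unit ℂ)]
    simp [Matrix.trace, LinearMap.toMatrix_apply]
  rw [h, LinearMap.trace_prodMap', LinearMap.trace_comp_comm', h2, two_mul]

/-- The kernel of a nonzero form on a plane is a line, and `a` is a nonzero vector in it. -/
theorem exists_eq_smul_of_apply_eq_zero (hW : finrank ℂ W = 2) (ha : a ≠ 0) (hb : b ≠ 0)
    (hba : b a = 0) {u : W} (hu : b u = 0) : ∃ c : ℂ, u = c • a := by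
  have : FiniteDimensional ℂ W := FiniteDimensional.of_finrank_pos (by omega)
  have hr : finrank ℂ (LinearMap.range b) = 1 := by
    rw [LinearMap.range_eq_top.2 (LinearMap.surjective hb), finrank_top, finrank_self]
  have hk : finrank ℂ (LinearMap.ker b) = 1 := by
    have := b.finrank_range_add_finrank_ker
    omega
  obtain ⟨c, hc⟩ := (finrank_eq_one_iff_of_nonzero' (⟨a, hba⟩ : LinearMap.ker b)
    (by simpa [Subtype.ext_iff] using ha)).1 hk ⟨u, hu⟩
  exact ⟨c, (congrArg Subtype.val hc).symm⟩

/-- The invariant subspaces of a regular nilpotent off-diagonal endomorphism. -/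
theorem eq_span_or_eq_sup_of_invariant (hW : finrank ℂ W = 2) (ha : a ≠ 0) (hb : b ≠ 0)
    (hba : b a = 0) (hT : ∀ u c, T (u, c) = (c • a, b u)) {S : Submodule ℂ (W × ℂ)}
    (hS : ∀ w ∈ S, T w ∈ S) (hbot : S ≠ ⊥) (htop : S ≠ ⊤) :
    S = Submodule.span ℂ {(a, 0)} ∨
      S = Submodule.prod ⊥ ⊤ ⊔ Submodule.span ℂ {((a, 0) : W × ℂ)} := by
  have mem_smul : ∀ {c : ℂ} {w : W × ℂ}, c ≠ 0 → c • w ∈ S → w ∈ S := fun hc h =>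
    (S.smul_mem_iff hc).1 h
  -- A vector with `b u ≠ 0` is cyclic: it and its images under `T` and `T²` span the whole space,
  -- which `htop` forbids.
  have hker : ∀ u c, (u, c) ∈ S → b u = 0 := by
    intro u c huc
    by_contra hbu
    refine htop (eq_top_iff.2 fun w _ => ?_)
    have h1 : (c • a, b u) ∈ S := hT u c ▸ hS _ huc
    have h2 : ((b u • a, 0) : W × ℂ) ∈ S := by simpa [hT, hba] using hS _ h1
    have h3 : ((a, 0) : W × ℂ) ∈ S := mem_smul hbu (by simpa using h2)
    have h4 : ((0, 1) : W × ℂ) ∈ S := by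
      refine mem_smul hbu ?_
      simpa using S.sub_mem h1 (S.smul_mem c h3)
    have h5 : ((u, 0) : W × ℂ) ∈ S := by
      simpa using S.sub_mem huc (S.smul_mem c h4)
    obtain ⟨w, d⟩ := w
    -- Subtracting the multiple of `u` with the same value under `b` leaves a vector of `ker b`, the
    -- line of `a`.
    obtain ⟨e, he⟩ := exists_eq_smul_of_apply_eq_zero hW ha hb hba
      (u := w - (b w / b u) • u) (by simp [hbu])
    have hw : w = (b w / b u) • u + e • a := by rw [← he]; abel
    have := S.add_mem (S.add_mem (S.smul_mem (b w / b u) h5) (S.smul_mem e h3)) (S.smul_mem d h4)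
    rw [hw]
    simpa using this
  have hspan : ∀ u c, (u, c) ∈ S → ∃ d : ℂ, u = d • a := fun u c h =>
    exists_eq_smul_of_apply_eq_zero hW ha hb hba (hker u c h)
  by_cases h0 : ∀ w ∈ S, w.2 = 0
  · left
    obtain ⟨⟨u, c⟩, hw, hne⟩ := S.ne_bot_iff.1 hbot
    obtain rfl : c = 0 := h0 _ hw
    obtain ⟨d, rfl⟩ := hspan u 0 hw
    have hd : d ≠ 0 := by rintro rfl; simp at hne
    apply le_antisymm
    · rintro ⟨u, c⟩ hu
      obtain rfl : c = 0 := h0 _ hu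
      obtain ⟨d, rfl⟩ := hspan u 0 hu
      exact Submodule.mem_span_singleton.2 ⟨d, by simp⟩
    · rw [Submodule.span_singleton_le_iff_mem]
      exact mem_smul hd (by simpa using hw)
  · right
    push Not at h0
    obtain ⟨⟨u, c⟩, hw, hc⟩ := h0
    replace hc : c ≠ 0 := hc
    obtain ⟨d, rfl⟩ := hspan u c hw
    -- `T (d • a, c) = (c • a, 0)`, and `c ≠ 0`.
    have h3 : ((a, 0) : W × ℂ) ∈ S := mem_smul hc (by simpa [hT, hba] using hS _ hw)
    have h4 : ((0, 1) : W × ℂ) ∈ S := mem_smul hc (by simpa using S.sub_mem hw (S.smul_mem d h3))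
    apply le_antisymm
    · rintro ⟨u, c⟩ hu
      obtain ⟨d, rfl⟩ := hspan u c hu
      refine Submodule.mem_sup.2 ⟨(0, c), by simp, (d • a, 0),
        Submodule.mem_span_singleton.2 ⟨d, by simp⟩, by simp⟩
    · refine sup_le ?_ ?_
      · rintro ⟨u, c⟩ ⟨hu, -⟩
        obtain rfl : u = 0 := by simpa using hu
        simpa using S.smul_mem c h4
      · rwa [Submodule.span_singleton_le_iff_mem]

end LinearAlgebra

/-! ### Logarithmic Higgs fields as local holomorphic endomorphisms -/

section Higgs

variable {X : Type*} [TopologicalSpace X] [ChartedSpace ℂ X] [IsManifold 𝓘(ℂ) ω X]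

theorem eventually_notMem_finset [T1Space X] (P : Finset X) (x : X) : ∀ᶠ y in 𝓝[≠] x, y ∉ P := by
  have h : ((P : Set X) \ {x})ᶜ ∈ 𝓝 x :=
    (P.finite_toSet.subset Set.sdiff_subset).isClosed.isOpen_compl.mem_nhds (by simp)
  filter_upwards [nhdsWithin_le_nhds h, self_mem_nhdsWithin] with y hy hne hyP
  exact hy ⟨hyP, hne⟩

/-- The identity principle for a property that, outside a finite set, is locally given by
finitely many holomorphic equations. -/
theorem eventually_not_of_equations [T1Space X] [PreconnectedSpace X] {P : Finset X}
    {G : Type*} [NormedAddCommGroup G] [NormedSpace ℂ G] [CompleteSpace G] {p : X → Prop}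
    (hp : ∀ x, ∃ (k : ℕ) (f : Fin k → X → G), (∀ i, ContMDiffAt 𝓘(ℂ) 𝓘(ℂ, G) ω (f i) x) ∧
      ∀ᶠ y in 𝓝 x, y ∉ P → (p y ↔ ∀ i, f i y = 0))
    (hx : ∃ x, x ∉ P ∧ ¬ p x) (x : X) : ∀ᶠ y in 𝓝[≠] x, ¬ p y := by
  refine eventually_not_of_dichotomy (fun x => ?_) ?_ x
  · obtain ⟨k, f, hf, hpf⟩ := hp x
    by_cases h : ∀ i, ∀ᶠ y in 𝓝 x, f i y = 0
    · left
      filter_upwards [nhdsWithin_le_nhds (eventually_all.2 h), nhdsWithin_le_nhds hpf,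
        eventually_notMem_finset P x] with y h1 h2 h3 using (h2 h3).2 h1
    · right
      push Not at h
      obtain ⟨i, hi⟩ := h
      have := (eventually_eq_zero_or_eventually_ne_zero (hf i)).resolve_left
        fun h => (h.and_frequently hi).exists.elim fun _ h => h.2 h.1
      filter_upwards [this, nhdsWithin_le_nhds hpf,
        eventually_notMem_finset P x] with y h1 h2 h3 h4 using h1 ((h2 h3).1 h4 i)
  · obtain ⟨x, hxP, hx⟩ := hx
    obtain ⟨k, f, hf, hpf⟩ := hp x
    rw [hpf.self_of_nhds hxP] at hx
    push Not at hx
    obtain ⟨i, hi⟩ := hx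
    refine ⟨x, ?_⟩
    filter_upwards [nhdsWithin_le_nhds ((hf i).continuousAt.eventually_ne hi),
      nhdsWithin_le_nhds hpf, eventually_notMem_finset P x] with y h1 h2 h3 h4
      using h1 ((h2 h3).1 h4 i)

/-- Tangent spaces are lines and the coordinate field is nonzero near `x`, so one vector controls
all values of `Φ`. -/
theorem eventually_coordVector_spans (x : X) : ∀ᶠ y in 𝓝 x,
    ∀ w : TangentSpace 𝓘(ℂ) y, ∃ c : ℂ, w = c • coordVector x y := by
  set t := trivializationAt ℂ (TangentSpace 𝓘(ℂ) : X → Type _) x with ht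
  filter_upwards [eventually_mem_baseSet (F := ℂ) (E := (TangentSpace 𝓘(ℂ) : X → Type _)) x]
    with y hy w
  refine ⟨t.linearMapAt ℂ y w, ?_⟩
  have h : coordVector x y = t.symmₗ ℂ y 1 := (t.symmₗ_apply hy 1).symm
  rw [h, ← map_smul, smul_eq_mul, mul_one]
  exact (t.symmₗ_linearMapAt hy w).symm

variable {P : Finset X}
  {F : Type*} [NormedAddCommGroup F] [NormedSpace ℂ F]
  {E : X → Type*} [TopologicalSpace (TotalSpace F E)]
  [∀ x, AddCommGroup (E x)] [∀ x, Module ℂ (E x)] [∀ x, TopologicalSpace (E x)]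
  [∀ x, IsTopologicalAddGroup (E x)] [∀ x, ContinuousSMul ℂ (E x)]
  [FiberBundle F E] [VectorBundle ℂ F E] (Φ : LogHiggsField P F E)

variable {Φ} in
theorem LogHiggsField.form_smul_apply (y : X) (c : ℂ) (v : TangentSpace 𝓘(ℂ) y) (w : E y) :
    Φ.form y (c • v) w = c • Φ.form y v w := by
  rw [map_smul]; rfl

open Classical in
/-- The section of `End E` that represents `Φ` near `x` with respect to the frame `dz` of the
logarithmic canonical bundle, or `dz / z` if `x ∈ P`. -/
noncomputable def LogHiggsField.localForm (x y : X) : E y →L[ℂ] E y :=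
  if x ∈ P then
    if y = x then Φ.res y else
      (extChartAt 𝓘(ℂ) x y - extChartAt 𝓘(ℂ) x x) • Φ.form y (coordVector x y)
  else Φ.form y (coordVector x y)

theorem LogHiggsField.isHolAt_localForm (x : X) :
    IsHolAt (F →L[ℂ] F) (E := fun y => E y →L[ℂ] E y) (Φ.localForm x) x := by
  by_cases hx : x ∈ P
  · have := Φ.simple_pole x hx
    unfold LogHiggsField.localForm
    simpa only [hx, if_true] using this
  · have := Φ.holomorphic x hx
    unfold LogHiggsField.localForm
    simpa only [hx, if_false] using this

theorem LogHiggsField.isHolAt_localForm_apply {x : X} {s : ∀ y, E y} (hs : IsHolAt F s x) :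
    IsHolAt F (fun y => Φ.localForm x y (s y)) x :=
  ContMDiffAt.clm_bundle_apply (b := id) (Φ.isHolAt_localForm x) hs

/-- At a pole, the factor `z(y) - z(x)` is nonzero for `y ≠ x`, so the rescaled coordinate vector
still spans. Fibrewise conditions on `Φ` thereby become conditions on a holomorphic endomorphism. -/
theorem LogHiggsField.eventually_localForm_eq (x : X) : ∀ᶠ y in 𝓝 x, y ∉ P →
    ∃ v, Φ.localForm x y = Φ.form y v ∧ ∀ w : TangentSpace 𝓘(ℂ) y, ∃ c : ℂ, w = c • v := by
  filter_upwards [eventually_coordVector_spans x,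
    extChartAt_source_mem_nhds (I := 𝓘(ℂ)) x] with y hy hys hyP
  by_cases hx : x ∈ P
  · have hne : y ≠ x := fun h => hyP (h ▸ hx)
    have hz : extChartAt 𝓘(ℂ) x y - extChartAt 𝓘(ℂ) x x ≠ 0 := sub_ne_zero.2 fun h =>
      hne ((extChartAt 𝓘(ℂ) x).injOn hys (mem_extChartAt_source x) h)
    refine ⟨(extChartAt 𝓘(ℂ) x y - extChartAt 𝓘(ℂ) x x) • coordVector x y, ?_, fun w => ?_⟩
    · simp only [LogHiggsField.localForm, hx, hne, if_true, if_false]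
      exact (map_smul (Φ.form y) _ _).symm
    · obtain ⟨c, rfl⟩ := hy w
      exact ⟨c * (extChartAt 𝓘(ℂ) x y - extChartAt 𝓘(ℂ) x x)⁻¹, by
        rw [smul_smul, mul_assoc, inv_mul_cancel₀ hz, mul_one]⟩
  · exact ⟨coordVector x y, by simp only [LogHiggsField.localForm, hx, if_false], hy⟩

/-- A subbundle is invariant if it is invariant outside a discrete set. -/
theorem isInvariant_of_eventually [T1Space X] {S : HolSubbundle F E}
    (h : ∀ x, ∀ᶠ y in 𝓝[≠] x, ∀ v, ∀ w ∈ S.carrier y, Φ.form y v w ∈ S.carrier y) :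
    IsInvariant Φ S := by
  -- The local form treats poles and ordinary points alike: applied to a local section of `S` it is
  -- holomorphic and lies in `S` off `x`, hence also at `x`.
  have key : ∀ x, ∀ w ∈ S.carrier x, Φ.localForm x x w ∈ S.carrier x := by
    intro x w hw
    obtain ⟨e, he⟩ := S.exists_frame x
    obtain ⟨s, hs, rfl, hsS⟩ := he.exists_section hw
    suffices hev : ∀ᶠ y in 𝓝[≠] x, Φ.localForm x y (s y) ∈ S.carrier y from
      he.mem_of_frequently (Φ.isHolAt_localForm_apply hs)
        (hev.frequently.filter_mono nhdsWithin_le_nhds)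
    filter_upwards [h x, nhdsWithin_le_nhds (Φ.eventually_localForm_eq x),
      eventually_notMem_finset P x, nhdsWithin_le_nhds hsS] with y h1 h2 h3 h4
    obtain ⟨v, hv, -⟩ := h2 h3
    rw [hv]
    exact h1 v _ h4
  refine ⟨fun x hx v w hw => ?_, fun p hp w hw => ?_⟩
  · obtain ⟨v', hv', hspan⟩ := (Φ.eventually_localForm_eq x).self_of_nhds hx
    obtain ⟨c, rfl⟩ := hspan v
    have h1 := (S.carrier x).smul_mem c (key x w hw)
    rw [hv'] at h1
    rw [map_smul]
    exact h1
  · have h1 := key p w hw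
    unfold LogHiggsField.localForm at h1
    simpa only [hp, if_true] using h1

end Higgs

/-! ### Generic regular nilpotency of the Higgs field -/

section OffDiagonal

variable {X : Type*} [TopologicalSpace X] [ChartedSpace ℂ X] [IsManifold 𝓘(ℂ) ω X]
  {P : Finset X}
  {F : Type*} [NormedAddCommGroup F] [NormedSpace ℂ F]
  {V : X → Type*} [TopologicalSpace (TotalSpace F V)]
  [∀ x, AddCommGroup (V x)] [∀ x, Module ℂ (V x)] [∀ x, TopologicalSpace (V x)]
  [∀ x, IsTopologicalAddGroup (V x)] [∀ x, ContinuousSMul ℂ (V x)]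
  [FiberBundle F V] [VectorBundle ℂ F V]

theorem eventually_coordAt_prod (s : ∀ y, V y × ℂ) (x : X) : ∀ᶠ y in 𝓝 x,
    coordAt (F × ℂ) (E := V ×ᵇ Bundle.Trivial X ℂ) x s y =
      (coordAt F x (fun y => (s y).1) y, (s y).2) := by
  filter_upwards [eventually_mem_baseSet (F := F × ℂ) (E := V ×ᵇ Bundle.Trivial X ℂ) x,
    eventually_mem_baseSet (F := F) (E := V) x] with y hy hy'
  rw [coordAt, coordAt, (trivializationAt F V x).coe_linearMapAt_of_mem hy',
    (trivializationAt (F × ℂ) (V ×ᵇ Bundle.Trivial X ℂ) x).coe_linearMapAt_of_mem hy]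
  rfl

theorem contMDiffAt_snd_of_isHolAt {s : ∀ y, V y × ℂ} {x : X}
    (hs : IsHolAt (F × ℂ) (E := V ×ᵇ Bundle.Trivial X ℂ) s x) :
    ContMDiffAt 𝓘(ℂ) 𝓘(ℂ, ℂ) ω (fun y => (s y).2) x := by
  have h := (ContinuousLinearMap.snd ℂ F ℂ).contMDiff.contMDiffAt.comp x
    (isHolAt_iff_coordAt.1 hs)
  refine h.congr_of_eventuallyEq ?_
  filter_upwards [eventually_coordAt_prod (F := F) s x] with y hy
  exact (congrArg Prod.snd hy).symm

theorem isHolAt_zero_one (x : X) :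
    IsHolAt (F × ℂ) (E := V ×ᵇ Bundle.Trivial X ℂ) (fun y => ((0 : V y), (1 : ℂ))) x := by
  rw [isHolAt_iff_coordAt]
  refine (contMDiffAt_const (c := ((0 : F), (1 : ℂ)))).congr_of_eventuallyEq ?_
  filter_upwards [eventually_coordAt_prod (F := F) (fun y => ((0 : V y), (1 : ℂ))) x] with y hy
  rw [hy]
  simp [coordAt]

variable (Φ : LogHiggsField P (F × ℂ) (V ×ᵇ Bundle.Trivial X ℂ))

/-- At `y` the Higgs field is, up to a scalar, the regular nilpotent endomorphism
`(u, c) ↦ (c • a, b u)` with `a ≠ 0`, `b ≠ 0` and `b a = 0`. -/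
def IsRegularNilpotentAt (y : X) : Prop :=
  ∃ (a : V y) (b : V y →ₗ[ℂ] ℂ) (v : TangentSpace 𝓘(ℂ) y), a ≠ 0 ∧ b ≠ 0 ∧ b a = 0 ∧
    (∀ w : TangentSpace 𝓘(ℂ) y, ∃ c : ℂ, w = c • v) ∧ ∀ u c, Φ.form y v (u, c) = (c • a, b u)

variable {Φ}

variable (Φ) in
/-- `block₂` as a linear form. -/
noncomputable def block₂ₗ (y : X) (v : TangentSpace 𝓘(ℂ) y) : V y →ₗ[ℂ] ℂ :=
  LinearMap.snd ℂ (V y) ℂ ∘ₗ (Φ.form y v : (V y × ℂ) →ₗ[ℂ] V y × ℂ) ∘ₗ LinearMap.inl ℂ (V y) ℂ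

theorem form_apply_eq (hoff : IsOffDiagonal Φ) {y : X} (hy : y ∉ P) (v : TangentSpace 𝓘(ℂ) y)
    (u : V y) (c : ℂ) : Φ.form y v (u, c) = (c • block₁ Φ y v 1, block₂ₗ Φ y v u) := by
  have h : block₁ Φ y v c = c • block₁ Φ y v 1 := by
    have h1 := map_smul (Φ.form y v) c ((0 : V y), (1 : ℂ))
    have h2 : c • ((0 : V y), (1 : ℂ)) = (0, c) := by simp
    have h3 := congrArg Prod.fst h1
    rw [h2] at h3
    exact h3
  rw [hoff y hy v u c, h]
  rfl

theorem block₁_smul_apply (hoff : IsOffDiagonal Φ) {y : X} (hy : y ∉ P)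
    (d : ℂ) (v : TangentSpace 𝓘(ℂ) y) (c : ℂ) :
    block₁ Φ y (d • v) c = d • c • block₁ Φ y v 1 := by
  have h : Φ.form y (d • v) ((0 : V y), c) = d • (Φ.form y v (0, c) : V y × ℂ) :=
    LogHiggsField.form_smul_apply (Φ := Φ) y d v _
  rw [form_apply_eq hoff hy v 0 c] at h
  exact congrArg Prod.fst h

theorem block₂_smul_apply (y : X) (d : ℂ) (v : TangentSpace 𝓘(ℂ) y) (u : V y) :
    block₂ Φ y (d • v) u = d * block₂ₗ Φ y v u :=
  congrArg Prod.snd (LogHiggsField.form_smul_apply (Φ := Φ) y d v (u, (0 : ℂ)))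

/-- Since `v` spans the tangent line, a block vanishing on `v` would vanish on every tangent vector;
the trace condition supplies `b a = 0`. -/
theorem isRegularNilpotentAt_of_ne_zero {y : X} [FiniteDimensional ℂ (V y)]
    (hoff : IsOffDiagonal Φ) (htr : TraceSqEqZero Φ) (hy : y ∉ P) {v : TangentSpace 𝓘(ℂ) y}
    (hv : ∀ w : TangentSpace 𝓘(ℂ) y, ∃ c : ℂ, w = c • v)
    (h₁ : ¬ ∀ v c, block₁ Φ y v c = 0) (h₂ : ¬ ∀ v u, block₂ Φ y v u = 0) :
    IsRegularNilpotentAt Φ y := by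
  refine ⟨block₁ Φ y v 1, block₂ₗ Φ y v, v, fun h => h₁ fun w c => ?_, fun h => h₂ fun w u => ?_,
    ?_, hv, form_apply_eq hoff hy v⟩
  · obtain ⟨d, rfl⟩ := hv w
    rw [block₁_smul_apply hoff hy, h, smul_zero, smul_zero]
  · obtain ⟨d, rfl⟩ := hv w
    rw [block₂_smul_apply, h, LinearMap.zero_apply, mul_zero]
  · have h3 := htr y hy v
    rw [trace_comp_self_of_offDiagonal (a := block₁ Φ y v 1) (b := block₂ₗ Φ y v)
      (fun u c => form_apply_eq hoff hy v u c)] at h3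
    simpa using h3

theorem span_pair_eq (y : X) (a : V y) :
    Submodule.span ℂ (Set.range ![((0 : V y), (1 : ℂ)), (a, 0)]) =
      Submodule.prod ⊥ ⊤ ⊔ Submodule.span ℂ {((a, 0) : V y × ℂ)} := by
  rw [Matrix.range_cons, Matrix.range_cons, Matrix.range_empty, Set.union_empty,
    Submodule.span_union]
  congr 1
  ext ⟨u, c⟩
  simp [Submodule.mem_span_singleton, eq_comm]

namespace IsRegularNilpotentAt

variable {y : X}

theorem imageBlock₁_eq_span {a : V y} {b : V y →ₗ[ℂ] ℂ} {v : TangentSpace 𝓘(ℂ) y}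
    (hv : ∀ w : TangentSpace 𝓘(ℂ) y, ∃ c : ℂ, w = c • v)
    (h : ∀ u c, Φ.form y v (u, c) = (c • a, b u)) :
    imageBlock₁ Φ y = Submodule.span ℂ {((a, 0) : V y × ℂ)} := by
  apply le_antisymm
  · refine Submodule.span_le.2 ?_
    rintro _ ⟨w, c, rfl⟩
    obtain ⟨d, rfl⟩ := hv w
    have h3 : Φ.form y (d • v) ((0 : V y), c) = d • (Φ.form y v (0, c) : V y × ℂ) :=
      LogHiggsField.form_smul_apply (Φ := Φ) y d v _
    rw [h] at h3
    have h4 : block₁ Φ y (d • v) c = d • c • a := congrArg Prod.fst h3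
    refine Submodule.mem_span_singleton.2 ⟨d * c, ?_⟩
    rw [h4]
    simp [mul_smul]
  · rw [Submodule.span_singleton_le_iff_mem]
    refine Submodule.subset_span ⟨v, 1, ?_⟩
    have h4 : block₁ Φ y v 1 = (1 : ℂ) • a := congrArg Prod.fst (h 0 1)
    rw [h4, one_smul]

/-- The relation `b a = 0` puts the line of `a` inside `ker b`, and rank 2 makes them equal. -/
theorem kerBlock₂_eq (hV : finrank ℂ (V y) = 2) (hy : IsRegularNilpotentAt Φ y) :
    kerBlock₂ Φ y = imageBlock₁ Φ y := by
  obtain ⟨a, b, v, ha, hb, hba, hv, h⟩ := hy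
  rw [imageBlock₁_eq_span hv h]
  have hb2 : ∀ u, block₂ Φ y v u = b u := fun u => congrArg Prod.snd (h u 0)
  ext ⟨u, c⟩
  constructor
  · rintro ⟨hc, hu⟩
    obtain rfl : c = 0 := hc
    obtain ⟨d, rfl⟩ := exists_eq_smul_of_apply_eq_zero hV ha hb hba ((hb2 u).symm.trans (hu v))
    exact Submodule.mem_span_singleton.2 ⟨d, by simp⟩
  · intro hu
    obtain ⟨d, hd⟩ := Submodule.mem_span_singleton.1 hu
    obtain ⟨rfl, rfl⟩ : d • a = u ∧ 0 = c := by simpa using hd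
    refine ⟨rfl, fun w => ?_⟩
    obtain ⟨e, rfl⟩ := hv w
    have h3 : Φ.form y (e • v) (d • a, (0 : ℂ)) = e • (Φ.form y v (d • a, 0) : V y × ℂ) :=
      LogHiggsField.form_smul_apply (Φ := Φ) y e v _
    rw [h] at h3
    exact (congrArg Prod.snd h3).trans (by simp [hba])

theorem form_apply_mem_imageBlock₁ (hy : IsRegularNilpotentAt Φ y) (w : TangentSpace 𝓘(ℂ) y)
    {e : V y × ℂ} (he : e ∈ imageBlock₁ Φ y) : Φ.form y w e ∈ imageBlock₁ Φ y := by
  obtain ⟨a, b, v, ha, hb, hba, hv, h⟩ := hy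
  rw [imageBlock₁_eq_span hv h] at he ⊢
  obtain ⟨d, rfl⟩ := Submodule.mem_span_singleton.1 he
  obtain ⟨c, rfl⟩ := hv w
  have h3 : Φ.form y (c • v) (d • (a, (0 : ℂ))) = c • (Φ.form y v (d • (a, (0 : ℂ))) : V y × ℂ) :=
    LogHiggsField.form_smul_apply (Φ := Φ) y c v _
  have h4 : d • (a, (0 : ℂ)) = (d • a, (0 : ℂ)) := by simp
  rw [h3, h4, h]
  -- The coefficient is zero because `T` kills `(a, 0)`.
  refine Submodule.mem_span_singleton.2 ⟨0, ?_⟩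
  simp only [zero_smul, map_smul, hba, smul_zero]
  exact (smul_zero c).symm

theorem form_apply_mem_sup (hy : IsRegularNilpotentAt Φ y) (w : TangentSpace 𝓘(ℂ) y)
    {e : V y × ℂ} (he : e ∈ Submodule.prod ⊥ ⊤ ⊔ imageBlock₁ Φ y) :
    Φ.form y w e ∈ Submodule.prod ⊥ ⊤ ⊔ imageBlock₁ Φ y := by
  obtain ⟨a, b, v, ha, hb, hba, hv, h⟩ := hy
  rw [imageBlock₁_eq_span hv h] at he ⊢
  obtain ⟨⟨u, c⟩, ⟨hu, -⟩, f, hf, rfl⟩ := Submodule.mem_sup.1 he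
  obtain rfl : u = 0 := by simpa using hu
  obtain ⟨d, rfl⟩ := Submodule.mem_span_singleton.1 hf
  obtain ⟨g, rfl⟩ := hv w
  have h4 : ((0 : V y), c) + d • (a, (0 : ℂ)) = (d • a, c) := by simp
  have h3 : Φ.form y (g • v) (d • a, c) = g • (Φ.form y v (d • a, c) : V y × ℂ) :=
    LogHiggsField.form_smul_apply (Φ := Φ) y g v _
  rw [h4, h3, h]
  refine Submodule.mem_sup_right (Submodule.mem_span_singleton.2 ⟨g * c, ?_⟩)
  simp [hba, mul_smul]

theorem eq_or_eq_of_invariant (hV : finrank ℂ (V y) = 2) (hy : IsRegularNilpotentAt Φ y)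
    {S : Submodule ℂ (V y × ℂ)} (hS : ∀ v, ∀ w ∈ S, Φ.form y v w ∈ S) (hbot : S ≠ ⊥)
    (htop : S ≠ ⊤) : S = imageBlock₁ Φ y ∨ S = Submodule.prod ⊥ ⊤ ⊔ imageBlock₁ Φ y := by
  obtain ⟨a, b, v, ha, hb, hba, hv, h⟩ := hy
  rw [imageBlock₁_eq_span hv h]
  exact eq_span_or_eq_sup_of_invariant hV ha hb hba
    (T := (Φ.form y v : (V y × ℂ) →ₗ[ℂ] V y × ℂ)) h (hS v) hbot htop

end IsRegularNilpotentAt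

theorem finrank_fibre (y : X) : finrank ℂ (V y) = finrank ℂ F :=
  LinearEquiv.finrank_eq ((trivializationAt F V y).linearEquivAt ℂ y
    (FiberBundle.mem_baseSet_trivializationAt' y))

theorem finiteDimensional_fibre [FiniteDimensional ℂ F] (y : X) : FiniteDimensional ℂ (V y) :=
  LinearEquiv.finiteDimensional ((trivializationAt F V y).linearEquivAt ℂ y
    (FiberBundle.mem_baseSet_trivializationAt' y)).symm

section Connected

variable [T1Space X] [PreconnectedSpace X] [FiniteDimensional ℂ F]

/-- By linearity `Φ₁` vanishes at `y` exactly when the local form kills `(0, 1)`, a single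
holomorphic equation. -/
theorem eventually_block₁_ne_zero (hoff : IsOffDiagonal Φ)
    (hΦ₁ : ∃ x, x ∉ P ∧ ∃ v c, block₁ Φ x v c ≠ 0) (x : X) :
    ∀ᶠ y in 𝓝[≠] x, ¬ ∀ v c, block₁ Φ y v c = 0 := by
  have : CompleteSpace (F × ℂ) := FiniteDimensional.complete ℂ (F × ℂ)
  refine eventually_not_of_equations (P := P) (G := F × ℂ) (fun x => ?_) ?_ x
  · have hs := Φ.isHolAt_localForm_apply (isHolAt_zero_one x)
    refine ⟨1, fun _ => coordAt (F × ℂ) (E := V ×ᵇ Bundle.Trivial X ℂ) x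
      fun y => Φ.localForm x y ((0 : V y), (1 : ℂ)), fun _ => isHolAt_iff_coordAt.1 hs, ?_⟩
    filter_upwards [Φ.eventually_localForm_eq x,
      eventually_mem_baseSet (F := F × ℂ) (E := V ×ᵇ Bundle.Trivial X ℂ) x] with y hy hyb hyP
    obtain ⟨v, hv, hspan⟩ := hy hyP
    have h1 : Φ.localForm x y ((0 : V y), (1 : ℂ)) = (block₁ Φ y v 1, (0 : ℂ)) := by
      rw [hv, form_apply_eq hoff hyP v 0 1, map_zero, one_smul]
    rw [forall_const]
    refine ⟨fun h => ?_, fun h w c => ?_⟩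
    · by_contra hne
      refine (coordAt_ne_zero_iff hyb).1 hne (h1.trans ?_)
      rw [h]
      rfl
    · obtain ⟨d, rfl⟩ := hspan w
      have h2 : Φ.localForm x y ((0 : V y), (1 : ℂ)) = 0 :=
        not_not.1 fun hne => (coordAt_ne_zero_iff hyb).2 hne h
      have h3 : block₁ Φ y v 1 = 0 := congrArg Prod.fst (h1.symm.trans h2)
      rw [block₁_smul_apply hoff hyP, h3, smul_zero, smul_zero]
  · obtain ⟨x, hx, v, c, h⟩ := hΦ₁
    exact ⟨x, hx, fun h' => h (h' v c)⟩

/-- The equations are the `ℂ`-components of the local form on a frame of `V ⊕ 𝒪`. Those components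
depend only on the `V`-parts, which span the fibre of `V`. -/
theorem eventually_block₂_ne_zero [ContMDiffVectorBundle ω F V 𝓘(ℂ)] (hoff : IsOffDiagonal Φ)
    (hΦ₂ : ∃ x, x ∉ P ∧ ∃ v u, block₂ Φ x v u ≠ 0) (x : X) :
    ∀ᶠ y in 𝓝[≠] x, ¬ ∀ v u, block₂ Φ y v u = 0 := by
  refine eventually_not_of_equations (P := P) (G := ℂ) (fun x => ?_) ?_ x
  · obtain ⟨e, he⟩ := (whole (F × ℂ) (V ×ᵇ Bundle.Trivial X ℂ)).exists_frame x
    refine ⟨_, fun i y => (Φ.localForm x y (e i y)).2, fun i =>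
      contMDiffAt_snd_of_isHolAt (Φ.isHolAt_localForm_apply (he.1 i)), ?_⟩
    filter_upwards [Φ.eventually_localForm_eq x, he.2] with y hy hey hyP
    obtain ⟨v, hv, hspan⟩ := hy hyP
    have h1 : ∀ w : V y × ℂ, (Φ.localForm x y w).2 = block₂ₗ Φ y v w.1 := fun w => by
      rw [hv]
      have h2 := congrArg Prod.snd (form_apply_eq hoff hyP v w.1 w.2)
      exact h2
    refine ⟨fun h i => (h1 _).trans (h v _), fun h w u => ?_⟩
    obtain ⟨d, rfl⟩ := hspan w
    have h2 : block₂ₗ Φ y v ∘ₗ LinearMap.fst ℂ (V y) ℂ = 0 :=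
      LinearMap.ext_on_range hey.2 fun i => (h1 _).symm.trans (h i)
    have h3 : block₂ₗ Φ y v u = 0 := LinearMap.congr_fun h2 (u, 0)
    rw [block₂_smul_apply, h3, mul_zero]
  · obtain ⟨x, hx, v, c, h⟩ := hΦ₂
    exact ⟨x, hx, fun h' => h (h' v c)⟩

theorem eventually_isRegularNilpotentAt [ContMDiffVectorBundle ω F V 𝓘(ℂ)]
    (hoff : IsOffDiagonal Φ) (htr : TraceSqEqZero Φ)
    (hΦ₁ : ∃ x, x ∉ P ∧ ∃ v c, block₁ Φ x v c ≠ 0)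
    (hΦ₂ : ∃ x, x ∉ P ∧ ∃ v u, block₂ Φ x v u ≠ 0) (x : X) :
    ∀ᶠ y in 𝓝[≠] x, IsRegularNilpotentAt Φ y := by
  filter_upwards [eventually_block₁_ne_zero hoff hΦ₁ x, eventually_block₂_ne_zero hoff hΦ₂ x,
    eventually_notMem_finset P x, nhdsWithin_le_nhds (Φ.eventually_localForm_eq x)]
    with y h1 h2 h3 h4
  have := finiteDimensional_fibre (F := F) (V := V) y
  obtain ⟨v, -, hv⟩ := h4 h3
  exact isRegularNilpotentAt_of_ne_zero hoff htr h3 hv h1 h2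

end Connected

end OffDiagonal

/-! ### Construction and uniqueness of the invariant subbundles -/

section InvariantSubbundles

variable {X : Type*} [TopologicalSpace X] [ChartedSpace ℂ X] [IsManifold 𝓘(ℂ) ω X] [T1Space X]
  {P : Finset X}
  {F : Type*} [NormedAddCommGroup F] [NormedSpace ℂ F] [FiniteDimensional ℂ F]
  {V : X → Type*} [TopologicalSpace (TotalSpace F V)]
  [∀ x, AddCommGroup (V x)] [∀ x, Module ℂ (V x)] [∀ x, TopologicalSpace (V x)]
  [∀ x, IsTopologicalAddGroup (V x)] [∀ x, ContinuousSMul ℂ (V x)]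
  [FiberBundle F V] [VectorBundle ℂ F V] [ContMDiffVectorBundle ω F V 𝓘(ℂ)]
  {Φ : LogHiggsField P (F × ℂ) (V ×ᵇ Bundle.Trivial X ℂ)}

/-- Near `x`, the saturation of the image of `Φ₁` is generated by one holomorphic section. -/
theorem exists_generator (hreg : ∀ x, ∀ᶠ y in 𝓝[≠] x, IsRegularNilpotentAt Φ y) (x : X) :
    ∃ σ : ∀ y, V y × ℂ, IsHolAt (F × ℂ) (E := V ×ᵇ Bundle.Trivial X ℂ) σ x ∧
      (∀ᶠ y in 𝓝 x, σ y ≠ 0 ∧ (σ y).2 = 0) ∧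
      ∀ᶠ y in 𝓝[≠] x, imageBlock₁ Φ y = Submodule.span ℂ {σ y} := by
  have : CompleteSpace (F × ℂ) := FiniteDimensional.complete ℂ (F × ℂ)
  have himage : ∀ᶠ y in 𝓝[≠] x, ∃ a ≠ 0, Φ.localForm x y ((0 : V y), (1 : ℂ)) = (a, (0 : ℂ)) ∧
      imageBlock₁ Φ y = Submodule.span ℂ {((a, 0) : V y × ℂ)} := by
    filter_upwards [hreg x, nhdsWithin_le_nhds (Φ.eventually_localForm_eq x),
      eventually_notMem_finset P x] with y ⟨a, b, v, ha, hb, hba, hv, h⟩ h2 h3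
    obtain ⟨v', hv', hspan⟩ := h2 h3
    obtain ⟨c, rfl⟩ := hv v'
    -- If `c = 0`, the zero vector spans the tangent space, so `v = 0`, which forces `a = 0`.
    have hc : c ≠ 0 := by
      rintro rfl
      obtain ⟨d, hd⟩ := hspan v
      have hv0 : (0 : ℂ) • v = v := by rw [zero_smul, smul_zero] at hd; rw [zero_smul, hd]
      have h4 : Φ.form y ((0 : ℂ) • v) ((0 : V y), (1 : ℂ)) =
          (0 : ℂ) • (Φ.form y v (0, 1) : V y × ℂ) :=
        LogHiggsField.form_smul_apply (Φ := Φ) y 0 v _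
      rw [hv0, h, zero_smul] at h4
      have h5 : (1 : ℂ) • a = 0 := congrArg Prod.fst h4
      exact ha (by rw [← one_smul ℂ a, h5])
    have h4 : Φ.form y (c • v) ((0 : V y), (1 : ℂ)) = c • (Φ.form y v (0, 1) : V y × ℂ) :=
      LogHiggsField.form_smul_apply (Φ := Φ) y c v _
    refine ⟨c • a, smul_ne_zero hc ha, ?_, ?_⟩
    · rw [hv', h4, h]
      simp
    · rw [IsRegularNilpotentAt.imageBlock₁_eq_span hv h]
      have h5 : ((c • a, 0) : V y × ℂ) = c • (a, (0 : ℂ)) := by simp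
      rw [h5, Submodule.span_singleton_smul_eq (IsUnit.mk0 c hc)]
  rcases eventually_eq_zero_or_exists_saturated
    (Φ.isHolAt_localForm_apply (isHolAt_zero_one x)) with h | ⟨σ, hσ, hσx, c, hc, hcσ⟩
  · obtain ⟨y, ⟨a, ha, h1, -⟩, h2⟩ := (himage.and h).exists
    exact absurd (congrArg Prod.fst (h1.symm.trans h2)) ha
  · have hgen : ∀ᶠ y in 𝓝[≠] x, (σ y).2 = 0 ∧ imageBlock₁ Φ y = Submodule.span ℂ {σ y} := by
      filter_upwards [himage, hc, nhdsWithin_le_nhds hcσ] with y ⟨a, ha, h1, h2⟩ h3 h4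
      rw [h1] at h4
      have h5 : (0 : ℂ) = c y * (σ y).2 := congrArg Prod.snd h4
      refine ⟨(mul_eq_zero.1 h5.symm).resolve_left h3, ?_⟩
      rw [h2, h4]
      exact Submodule.span_singleton_smul_eq (IsUnit.mk0 _ h3) (σ y)
    have hsnd := contMDiffAt_snd_of_isHolAt hσ
    -- The second component is holomorphic and vanishes off `x`, so it vanishes at `x` too and `σ`
    -- stays in `V ⊕ 0`.
    have hsnd0 : ∀ᶠ y in 𝓝 x, (σ y).2 = 0 := by
      refine (eventually_eq_zero_or_eventually_ne_zero hsnd).resolve_right fun h => ?_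
      obtain ⟨y, h1, h2⟩ := (h.and hgen).exists
      exact h1 h2.1
    refine ⟨σ, hσ, ?_, hgen.mono fun _ h => h.2⟩
    have hne : ∀ᶠ y in 𝓝 x, σ y ≠ 0 := by
      have hb := eventually_mem_baseSet (F := F × ℂ) (E := V ×ᵇ Bundle.Trivial X ℂ) x
      have h1 := (coordAt_ne_zero_iff hb.self_of_nhds).2 hσx
      filter_upwards [(isHolAt_iff_coordAt.1 hσ).continuousAt.eventually_ne h1, hb] with y h2 h3
      exact (coordAt_ne_zero_iff h3).1 h2
    exact hne.and hsnd0

theorem exists_frame_W₁ (hreg : ∀ x, ∀ᶠ y in 𝓝[≠] x, IsRegularNilpotentAt Φ y) (x : X) :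
    ∃ σ : ∀ y, V y × ℂ, (∀ᶠ y in 𝓝 x, σ y ≠ 0 ∧ (σ y).2 = 0) ∧
      IsHolFrameAt (F × ℂ) (E := V ×ᵇ Bundle.Trivial X ℂ) (W₁ Φ) (fun _ : Fin 1 => σ) x ∧
      ∀ᶠ y in 𝓝[≠] x, imageBlock₁ Φ y = Submodule.span ℂ {σ y} := by
  obtain ⟨σ, hσ, hne, himage⟩ := exists_generator hreg x
  refine ⟨σ, hne, ?_, himage⟩
  -- The lines spanned by `σ` form a subbundle across `x` that agrees with the image of `Φ₁` off
  -- `x`; saturation therefore returns these lines.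
  have hframe : IsHolFrameAt (F × ℂ) (E := V ×ᵇ Bundle.Trivial X ℂ)
      (fun y => Submodule.span ℂ {σ y}) (fun _ : Fin 1 => σ) x := by
    refine ⟨fun _ => hσ, ?_⟩
    filter_upwards [hne] with y hy
    exact ⟨LinearIndependent.of_subsingleton 0 hy.1, by rw [Set.range_const]⟩
  exact hframe.saturation himage

theorem eventually_W₁_eq (hreg : ∀ x, ∀ᶠ y in 𝓝[≠] x, IsRegularNilpotentAt Φ y) (x : X) :
    ∀ᶠ y in 𝓝[≠] x, W₁ Φ y = imageBlock₁ Φ y := by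
  obtain ⟨σ, -, hframe, himage⟩ := exists_frame_W₁ hreg x
  filter_upwards [nhdsWithin_le_nhds hframe.2, himage] with y h1 h2
  rw [h2, ← h1.2, Set.range_const]

theorem exists_frame_W₂ (hreg : ∀ x, ∀ᶠ y in 𝓝[≠] x, IsRegularNilpotentAt Φ y) (x : X) :
    ∃ e : Fin 2 → ∀ y, V y × ℂ,
      IsHolFrameAt (F × ℂ) (E := V ×ᵇ Bundle.Trivial X ℂ) (W₂ Φ) e x := by
  obtain ⟨σ, hne, hframe, -⟩ := exists_frame_W₁ hreg x
  refine ⟨![fun y => ((0 : V y), (1 : ℂ)), σ],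
    Fin.forall_fin_two.2 ⟨isHolAt_zero_one x, hframe.1 0⟩, ?_⟩
  filter_upwards [hne, hframe.2] with y ⟨h1, h2⟩ ⟨_, h3⟩
  obtain ⟨a, ha⟩ : ∃ a : V y, σ y = (a, 0) := ⟨(σ y).1, Prod.ext rfl h2⟩
  have heq : (fun i => (![fun y => ((0 : V y), (1 : ℂ)), σ] : Fin 2 → ∀ y, V y × ℂ) i y) =
      ![((0 : V y), (1 : ℂ)), (a, 0)] := by
    ext1 i
    fin_cases i
    · rfl
    · exact ha
  rw [Set.range_const, ha] at h3
  have ha0 : a ≠ 0 := by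
    rintro rfl
    exact h1 ha
  constructor
  · rw [heq, LinearIndependent.pair_iff]
    intro s t hst
    simp only [Prod.smul_mk, smul_zero, Prod.mk_add_mk, zero_add, smul_eq_mul, mul_one,
      Prod.mk_eq_zero] at hst
    exact ⟨by simpa using hst.2, (smul_eq_zero.1 hst.1).resolve_right ha0⟩
  · rw [heq, W₂, ← h3]
    exact span_pair_eq y a

/-- `W₁` as a subbundle. -/
noncomputable def subbundleW₁ (hreg : ∀ x, ∀ᶠ y in 𝓝[≠] x, IsRegularNilpotentAt Φ y) :
    HolSubbundle (F × ℂ) (V ×ᵇ Bundle.Trivial X ℂ) where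
  carrier := W₁ Φ
  rank := 1
  exists_frame := fun x => let ⟨_, h⟩ := exists_frame_W₁ hreg x; ⟨_, h.2.1⟩

/-- `W₂` as a subbundle. -/
noncomputable def subbundleW₂ (hreg : ∀ x, ∀ᶠ y in 𝓝[≠] x, IsRegularNilpotentAt Φ y) :
    HolSubbundle (F × ℂ) (V ×ᵇ Bundle.Trivial X ℂ) where
  carrier := W₂ Φ
  rank := 2
  exists_frame := exists_frame_W₂ hreg

/-- Saturation sees only fibres off a discrete set, and there image and kernel coincide. -/
theorem W₁_eq_saturation_kerBlock₂ (hF : finrank ℂ F = 2)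
    (hreg : ∀ x, ∀ᶠ y in 𝓝[≠] x, IsRegularNilpotentAt Φ y) :
    W₁ Φ = saturation (F × ℂ) (E := V ×ᵇ Bundle.Trivial X ℂ) (kerBlock₂ Φ) := by
  funext x
  obtain ⟨σ, -, hframe, -⟩ := exists_frame_W₁ hreg x
  refine (hframe.saturation_eq ?_).symm
  filter_upwards [hreg x, eventually_W₁_eq hreg x] with y h1 h2
  rw [h2, h1.kerBlock₂_eq ((finrank_fibre (F := F) y).trans hF)]

theorem isInvariant_subbundleW₁ (hreg : ∀ x, ∀ᶠ y in 𝓝[≠] x, IsRegularNilpotentAt Φ y) :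
    IsInvariant Φ (subbundleW₁ hreg) := by
  refine isInvariant_of_eventually Φ fun x => ?_
  filter_upwards [hreg x, eventually_W₁_eq hreg x] with y h1 h2 v w hw
  change w ∈ W₁ Φ y at hw
  change _ ∈ W₁ Φ y
  rw [h2] at hw ⊢
  exact h1.form_apply_mem_imageBlock₁ v hw

theorem isInvariant_subbundleW₂ (hreg : ∀ x, ∀ᶠ y in 𝓝[≠] x, IsRegularNilpotentAt Φ y) :
    IsInvariant Φ (subbundleW₂ hreg) := by
  refine isInvariant_of_eventually Φ fun x => ?_
  filter_upwards [hreg x, eventually_W₁_eq hreg x] with y h1 h2 v w hw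
  change w ∈ W₂ Φ y at hw
  change _ ∈ W₂ Φ y
  rw [W₂, h2] at hw ⊢
  exact h1.form_apply_mem_sup v hw

/-- Two subbundles of the same rank that agree outside a discrete set are equal. -/
theorem HolSubbundle.eq_of_eventually_eq {G : Type*} [NormedAddCommGroup G] [NormedSpace ℂ G]
    {E : X → Type*} [TopologicalSpace (TotalSpace G E)]
    [∀ x, AddCommGroup (E x)] [∀ x, Module ℂ (E x)] [∀ x, TopologicalSpace (E x)]
    [FiberBundle G E] [VectorBundle ℂ G E] {S T : HolSubbundle G E} (hr : S.rank = T.rank)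
    (h : ∀ x, ∀ᶠ y in 𝓝[≠] x, S.carrier y = T.carrier y) : S = T := by
  refine HolSubbundle.eq_of_carrier_eq (funext fun x => ?_) hr
  obtain ⟨e, he⟩ := S.exists_frame x
  obtain ⟨f, hf⟩ := T.exists_frame x
  rw [← he.saturation_eq (Eventually.of_forall fun y => rfl), hf.saturation_eq (h x)]

/-- Generic fibres of an invariant subbundle are fibres of `W₁` or `W₂`. The alternative could a
priori vary with the point, but the constant rank of `S` fixes it. -/
theorem isInvariant_iff (hF : finrank ℂ F = 2)
    (hreg : ∀ x, ∀ᶠ y in 𝓝[≠] x, IsRegularNilpotentAt Φ y)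
    (S : HolSubbundle (F × ℂ) (V ×ᵇ Bundle.Trivial X ℂ)) :
    (0 < S.rank ∧ S.rank < 3 ∧ IsInvariant Φ S) ↔
      (S = subbundleW₁ hreg ∨ S = subbundleW₂ hreg) := by
  constructor
  · rintro ⟨h0, h3, hS⟩
    have key : ∀ x, ∀ᶠ y in 𝓝[≠] x, S.carrier y = W₁ Φ y ∨ S.carrier y = W₂ Φ y := by
      intro x
      filter_upwards [hreg x, eventually_W₁_eq hreg x, eventually_notMem_finset P x]
        with y h1 h2 hyP
      have hV : finrank ℂ (V y) = 2 := (finrank_fibre (F := F) y).trans hF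
      have : FiniteDimensional ℂ (V y) := finiteDimensional_fibre (F := F) y
      have hrank : finrank ℂ (S.carrier y : Submodule ℂ (V y × ℂ)) = S.rank :=
        S.finrank_carrier y
      rw [W₂, h2]
      refine h1.eq_or_eq_of_invariant hV (hS.1 y hyP) (fun h => ?_) fun h => ?_
      · rw [h, finrank_bot] at hrank
        omega
      · rw [h, finrank_top, finrank_prod, hV, finrank_self] at hrank
        omega
    have hrank₁ : ∀ y, S.carrier y = W₁ Φ y → S.rank = 1 := fun y h => by
      rw [← S.finrank_carrier y, h]
      exact (subbundleW₁ hreg).finrank_carrier y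
    have hrank₂ : ∀ y, S.carrier y = W₂ Φ y → S.rank = 2 := fun y h => by
      rw [← S.finrank_carrier y, h]
      exact (subbundleW₂ hreg).finrank_carrier y
    have hcases : S.rank = 1 ∨ S.rank = 2 := by omega
    refine hcases.imp (fun hr => ?_) fun hr => ?_
    · refine HolSubbundle.eq_of_eventually_eq hr fun x => ?_
      filter_upwards [key x] with y hy
      exact hy.resolve_right fun h => by have := hrank₂ y h; omega
    · refine HolSubbundle.eq_of_eventually_eq hr fun x => ?_
      filter_upwards [key x] with y hy
      exact hy.resolve_left fun h => by have := hrank₁ y h; omega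
  · rintro (rfl | rfl)
    · exact ⟨one_pos, (by decide : 1 < 3), isInvariant_subbundleW₁ hreg⟩
    · exact ⟨two_pos, (by decide : 2 < 3), isInvariant_subbundleW₂ hreg⟩

end InvariantSubbundles

end ParHiggs

/-! ### The stability criterion -/

theorem mainTheorem6
    {X : Type*} [TopologicalSpace X] [ChartedSpace ℂ X] [IsManifold 𝓘(ℂ) ω X]
    [T2Space X] [CompactSpace X] [ConnectedSpace X]
    (P : Finset X)
    {F : Type*} [NormedAddCommGroup F] [NormedSpace ℂ F] [FiniteDimensional ℂ F]
    (hF : Module.finrank ℂ F = 2)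
    {V : X → Type*} [TopologicalSpace (TotalSpace F V)]
    [∀ x, AddCommGroup (V x)] [∀ x, Module ℂ (V x)] [∀ x, TopologicalSpace (V x)]
    [∀ x, IsTopologicalAddGroup (V x)] [∀ x, ContinuousSMul ℂ (V x)]
    [FiberBundle F V] [VectorBundle ℂ F V] [ContMDiffVectorBundle ω F V 𝓘(ℂ)]
    (par : ∀ p : P, WeightedFlag ((V ×ᵇ Bundle.Trivial X ℂ) p))
    (Φ : LogHiggsField P (F × ℂ) (V ×ᵇ Bundle.Trivial X ℂ))
    (hoff : IsOffDiagonal Φ) (htr : TraceSqEqZero Φ)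
    (hΦ₁ : ∃ x, x ∉ P ∧ ∃ v c, block₁ Φ x v c ≠ 0)
    (hΦ₂ : ∃ x, x ∉ P ∧ ∃ v u, block₂ Φ x v u ≠ 0) :
    ∃ S₁ S₂ : HolSubbundle (F × ℂ) (V ×ᵇ Bundle.Trivial X ℂ),
      (S₁.carrier = W₁ Φ ∧ S₁.rank = 1) ∧
      S₁.carrier = saturation (F × ℂ) (E := V ×ᵇ Bundle.Trivial X ℂ) (kerBlock₂ Φ) ∧
      (S₂.carrier = W₂ Φ ∧ S₂.rank = 2) ∧
      (∀ S : HolSubbundle (F × ℂ) (V ×ᵇ Bundle.Trivial X ℂ),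
        (0 < S.rank ∧ S.rank < 3 ∧ IsInvariant Φ S) ↔ (S = S₁ ∨ S = S₂)) ∧
      (IsStable par Φ ↔
        parSlope par S₁ < parSlope par (whole (F × ℂ) (V ×ᵇ Bundle.Trivial X ℂ)) ∧
        parSlope par S₂ < parSlope par (whole (F × ℂ) (V ×ᵇ Bundle.Trivial X ℂ))) := by
  have hreg := eventually_isRegularNilpotentAt hoff htr hΦ₁ hΦ₂
  have hinv := isInvariant_iff hF hreg
  refine ⟨subbundleW₁ hreg, subbundleW₂ hreg, ⟨rfl, rfl⟩, W₁_eq_saturation_kerBlock₂ hF hreg,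
    ⟨rfl, rfl⟩, hinv, ?_⟩
  have h3 : Module.finrank ℂ (F × ℂ) = 3 := by
    rw [Module.finrank_prod, hF, Module.finrank_self]
  constructor
  · intro h
    obtain ⟨a₁, b₁, c₁⟩ := (hinv _).2 (Or.inl rfl)
    obtain ⟨a₂, b₂, c₂⟩ := (hinv _).2 (Or.inr rfl)
    exact ⟨h _ a₁ (h3 ▸ b₁) c₁, h _ a₂ (h3 ▸ b₂) c₂⟩
  · rintro ⟨h₁, h₂⟩ S hS0 hS3 hS
    rcases (hinv S).1 ⟨hS0, h3 ▸ hS3, hS⟩ with rfl | rfl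
    exacts [h₁, h₂]
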